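/- For $n\ge 0$ let $\mathfrak S_n$ be the set of permutations of $[n]=\{1,\dots,n\}$. For $\sigma\in\mathfrak S_n$ define the following numbers. - $\operatorname{des}\sigma$ is the number of descents, i.e. indices $i\in\{1,\dots,n-1\}$ with $\sigma(i)>\sigma(i+1)$. - $\operatorname{des}_2\sigma$ is the number of descents of type 2, i.e. descents $i$ such that $\sigma(j)<\sigma(i)$ for all $j<i$. - $\operatorname{exc}\sigma$ is the number of excedances, i.e. indices $i\in[n]$ with $\sigma(i)>i$. - $\operatorname{pex}\sigma$ is the number of pure excedances, i.e. excedances $i$ such that $\sigma(j)\notin[i,\sigma(i)]$ for all $j<i$. - $\operatorname{ear}\sigma$ is the number of exclusive antirecord cycle peaks, i.e. indices $i\in[n]$ such that $\sigma^{-1}(i)<i$ and $\sigma(i)<i$ ($i$ is a cycle peak), $\sigma(j)>\sigma(i)$ for all $j>i$ ($i$ is an antirecord), and it is not the case that $\sigma(j)<\sigma(i)$ for all $j<i$ ($i$ is not a record). - $\operatorname{pcyc}\sigma=\operatorname{cyc}\sigma-\operatorname{fix}\sigma$, where $\operatorname{cyc}\sigma$ is the number of cycles of $\sigma$ (fixed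 points included) and $\operatorname{fix}\sigma$ is the number of fixed points of $\sigma$. Two pairs of statistics $(a,b)$ and $(a',b')$ are equidistributed over $\mathfrak S_n$ if, for all integers $k,l\ge 0$, the number of $\sigma\in\mathfrak S_n$ with $(a\,\sigma,b\,\sigma)=(k,l)$ equals the number of $\sigma\in\mathfrak S_n$ with $(a'\sigma,b'\sigma)=(k,l)$. **Corollary.** For every $n\ge 0$ the four bistatistics $$(\operatorname{exc},\operatorname{pcyc}),\quad(\operatorname{exc},\operatorname{ear}),\quad(\operatorname{des},\operatorname{des}_2),\quad(\operatorname{exc},\operatorname{pex})$$ are equidistributed over $\mathfrak S_n$. In particular (Vajnovszki's conjecture) $(\operatorname{des}_2,\operatorname{des})$ and $(\operatorname{pex},\operatorname{exc})$ are equidistributed over $\mathfrak S_n$. -/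

import Mathlib

/-! Statistics of permutations. The symmetric group of `{1, …, n}` is `Equiv.Perm (Fin n)`:
the element `i : Fin n` stands for the index (or value) `i + 1`; all the notions below only compare
indices and values, so they are not affected by this shift. -/

namespace PermStat

variable {n : ℕ}

/-- `i` is a descent of `σ`: there is a next index `i + 1` and `σ (i) > σ (i + 1)`.
In particular the last index is never a descent. -/
def IsDescent (σ : Equiv.Perm (Fin n)) (i : Fin n) : Prop :=
  ∃ h : (i : ℕ) + 1 < n, σ ⟨(i : ℕ) + 1, h⟩ < σ i

instance (σ : Equiv.Perm (Fin n)) : DecidablePred (IsDescent σ) := fun i =>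
  inferInstanceAs (Decidable (∃ h : (i : ℕ) + 1 < n, σ ⟨(i : ℕ) + 1, h⟩ < σ i))

/-- `i` is a descent of type 2: a descent such that `σ j < σ i` for all `j < i`. -/
def IsDescent2 (σ : Equiv.Perm (Fin n)) (i : Fin n) : Prop :=
  IsDescent σ i ∧ ∀ j, j < i → σ j < σ i

instance (σ : Equiv.Perm (Fin n)) : DecidablePred (IsDescent2 σ) := fun i =>
  inferInstanceAs (Decidable (IsDescent σ i ∧ ∀ j, j < i → σ j < σ i))

/-- `i` is an excedance: `σ i > i` (the last index never satisfies this). -/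
def IsExcedance (σ : Equiv.Perm (Fin n)) (i : Fin n) : Prop :=
  i < σ i

instance (σ : Equiv.Perm (Fin n)) : DecidablePred (IsExcedance σ) := fun i =>
  inferInstanceAs (Decidable (i < σ i))

/-- `i` is a pure excedance: an excedance such that `σ j ∉ [i, σ i]` for all `j < i`. -/
def IsPureExcedance (σ : Equiv.Perm (Fin n)) (i : Fin n) : Prop :=
  IsExcedance σ i ∧ ∀ j, j < i → σ j ∉ Finset.Icc i (σ i)

instance (σ : Equiv.Perm (Fin n)) : DecidablePred (IsPureExcedance σ) := fun i =>
  inferInstanceAs (Decidable (IsExcedance σ i ∧ ∀ j, j < i → σ j ∉ Finset.Icc i (σ i)))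

/-- `i` is a record (left-to-right maximum). -/
def IsRecord (σ : Equiv.Perm (Fin n)) (i : Fin n) : Prop :=
  ∀ j, j < i → σ j < σ i

instance (σ : Equiv.Perm (Fin n)) : DecidablePred (IsRecord σ) := fun i =>
  inferInstanceAs (Decidable (∀ j, j < i → σ j < σ i))

/-- `i` is an antirecord (right-to-left minimum). -/
def IsAntirecord (σ : Equiv.Perm (Fin n)) (i : Fin n) : Prop :=
  ∀ j, i < j → σ i < σ j

instance (σ : Equiv.Perm (Fin n)) : DecidablePred (IsAntirecord σ) := fun i =>
  inferInstanceAs (Decidable (∀ j, i < j → σ i < σ j))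

/-- `i` is an exclusive antirecord: an antirecord that is not a record. -/
def IsExclusiveAntirecord (σ : Equiv.Perm (Fin n)) (i : Fin n) : Prop :=
  IsAntirecord σ i ∧ ¬ IsRecord σ i

instance (σ : Equiv.Perm (Fin n)) : DecidablePred (IsExclusiveAntirecord σ) := fun i =>
  inferInstanceAs (Decidable (IsAntirecord σ i ∧ ¬ IsRecord σ i))

/-- `i` is a cycle peak: `σ⁻¹ i < i > σ i`. -/
def IsCyclePeak (σ : Equiv.Perm (Fin n)) (i : Fin n) : Prop :=
  σ⁻¹ i < i ∧ σ i < i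

instance (σ : Equiv.Perm (Fin n)) : DecidablePred (IsCyclePeak σ) := fun i =>
  inferInstanceAs (Decidable (σ⁻¹ i < i ∧ σ i < i))

/-- `i` is an exclusive antirecord cycle peak. -/
def IsEar (σ : Equiv.Perm (Fin n)) (i : Fin n) : Prop :=
  IsExclusiveAntirecord σ i ∧ IsCyclePeak σ i

instance (σ : Equiv.Perm (Fin n)) : DecidablePred (IsEar σ) := fun i =>
  inferInstanceAs (Decidable (IsExclusiveAntirecord σ i ∧ IsCyclePeak σ i))

/-- Number of descents. -/
def des (σ : Equiv.Perm (Fin n)) : ℕ := (Finset.univ.filter (IsDescent σ)).card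

/-- Number of descents of type 2. -/
def des2 (σ : Equiv.Perm (Fin n)) : ℕ := (Finset.univ.filter (IsDescent2 σ)).card

/-- Number of excedances. -/
def exc (σ : Equiv.Perm (Fin n)) : ℕ := (Finset.univ.filter (IsExcedance σ)).card

/-- Number of pure excedances. -/
def pex (σ : Equiv.Perm (Fin n)) : ℕ := (Finset.univ.filter (IsPureExcedance σ)).card

/-- Number of exclusive antirecord cycle peaks. -/
def ear (σ : Equiv.Perm (Fin n)) : ℕ := (Finset.univ.filter (IsEar σ)).card

/-- Number of fixed points. -/
def fix (σ : Equiv.Perm (Fin n)) : ℕ := (Finset.univ.filter (fun i => σ i = i)).card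

instance (σ : Equiv.Perm (Fin n)) : DecidableRel (Equiv.Perm.SameCycle.setoid σ).r :=
  fun a b => inferInstanceAs (Decidable (σ.SameCycle a b))

instance (σ : Equiv.Perm (Fin n)) : DecidableEq (Quotient (Equiv.Perm.SameCycle.setoid σ)) :=
  @Quotient.decidableEq _ _ fun a b => inferInstanceAs (Decidable (σ.SameCycle a b))

/-- Number of cycles, fixed points included: the number of classes of the relation
"`i` and `j` lie in the same cycle of `σ`". -/
def cyc (σ : Equiv.Perm (Fin n)) : ℕ :=
  (Finset.univ.image
    (fun i : Fin n => (Quotient.mk (Equiv.Perm.SameCycle.setoid σ) i))).card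

/-- Number of nontrivial cycles, `cyc σ - fix σ`. -/
def pcyc (σ : Equiv.Perm (Fin n)) : ℕ := cyc σ - fix σ

/-- Every fixed point is a cycle of its own, so the subtraction in `pcyc` is never truncated. -/
theorem fix_le_cyc (σ : Equiv.Perm (Fin n)) : fix σ ≤ cyc σ := by
  unfold fix cyc
  refine Finset.card_le_card_of_injOn
    (fun i : Fin n => (Quotient.mk (Equiv.Perm.SameCycle.setoid σ) i)) ?_ ?_
  · intro i _
    exact Finset.mem_coe.2 (Finset.mem_image_of_mem _ (Finset.mem_univ i))
  · intro i hi j _ hij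
    have h : σ.SameCycle i j := Quotient.exact hij
    have hi' : σ i = i := by simpa using hi
    exact h.eq_of_left hi'

/-- Two bistatistics on the symmetric group are equidistributed: every pair of values is taken by
both equally often. -/
def Equidistributed (n : ℕ) (s t : Equiv.Perm (Fin n) → ℕ × ℕ) : Prop :=
  ∀ p : ℕ × ℕ, (Finset.univ.filter (fun σ => s σ = p)).card =
    (Finset.univ.filter (fun σ => t σ = p)).card

end PermStat

/-! Every bistatistic is compared with `(exc, pcyc)`, by two independent methods.

For `ear` and `pex`, fix the positions and values of the weak excedances. A permutation in such a
class is built from left to right: at an antiexcedance `i` any value below `i` not yet used may be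
taken, and the number of these, `height σ i`, depends only on the class. At a cycle peak exactly one
choice is the least, exactly one is the greatest, and exactly one closes a cycle with maximum `i`.
Marking any one of these kinds therefore gives the same product as generating function of the class
(`sum_choiceWeight`, `equidistributed_of_isUniqueChoice`). Cycle maxima give `pcyc` and least
choices give `ear`. Greatest choices give `pex` after conjugation by the reversal; this turns `exc`
into `aexc`, and inversion does the same while preserving `pcyc`.

For `des2`, each pair is refined to a triple, `(exc, pcyc, fix)` and `(des, des2, recordNondes)`.
Inserting a new least element, into a cycle or into the word, changes both triples by the same rule
`insertionStep`, so they are equidistributed by induction on `n`. -/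

namespace PermStat

variable {n : ℕ}

open Equiv Equiv.Perm Polynomial

/-! ### Classes of permutations with common weak excedances. -/

/-- `τ` has the same weak excedances as `σ`, with the same values, and agrees with `σ` at the
first `k` positions. -/
def SameWeakExc (k : ℕ) (σ τ : Perm (Fin n)) : Prop :=
  ∀ j : Fin n, ((j : ℕ) < k ∨ j ≤ σ j ∨ j ≤ τ j) → τ j = σ j

instance (k : ℕ) (σ τ : Perm (Fin n)) : Decidable (SameWeakExc k σ τ) :=
  inferInstanceAs (Decidable (∀ j : Fin n, ((j : ℕ) < k ∨ j ≤ σ j ∨ j ≤ τ j) → τ j = σ j))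

theorem SameWeakExc.symm {k : ℕ} {σ τ : Perm (Fin n)} (h : SameWeakExc k σ τ) :
    SameWeakExc k τ σ := fun j hj => (h j (by tauto)).symm

theorem SameWeakExc.trans {k : ℕ} {σ τ ρ : Perm (Fin n)} (h : SameWeakExc k σ τ)
    (h' : SameWeakExc k τ ρ) : SameWeakExc k σ ρ := by
  rintro j (hj | hj | hj)
  · rw [h' j (.inl hj), h j (.inl hj)]
  · have := h j (.inr (.inl hj))
    rw [h' j (.inr (.inl (this ▸ hj))), this]
  · have := h' j (.inr (.inr hj))
    rw [this, h j (.inr (.inr (this ▸ hj)))]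

theorem SameWeakExc.mono {k l : ℕ} (hkl : l ≤ k) {σ τ : Perm (Fin n)} (h : SameWeakExc k σ τ) :
    SameWeakExc l σ τ := fun j hj => h j (by rcases hj with hj | hj; exacts [.inl (by omega), .inr hj])

theorem SameWeakExc.le_iff {k : ℕ} {σ τ : Perm (Fin n)} (h : SameWeakExc k σ τ) (j : Fin n) :
    j ≤ τ j ↔ j ≤ σ j :=
  ⟨fun hj => h j (.inr (.inr hj)) ▸ hj, fun hj => (h j (.inr (.inl hj))).symm ▸ hj⟩

theorem SameWeakExc.lt_iff {k : ℕ} {σ τ : Perm (Fin n)} (h : SameWeakExc k σ τ) (j : Fin n) :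
    τ j < j ↔ σ j < j := by
  rw [← not_le, ← not_le, h.le_iff]

theorem SameWeakExc.inv_lt {k : ℕ} {σ τ : Perm (Fin n)} (h : SameWeakExc k σ τ) {i : Fin n}
    (hi : σ⁻¹ i < i) : τ⁻¹ i < i := by
  have : τ (σ⁻¹ i) = i := by
    rw [h (σ⁻¹ i) (.inr (.inl (by simpa using hi.le)))]; simp
  rwa [Perm.inv_eq_iff_eq.2 this.symm]

theorem SameWeakExc.inv_lt_iff {k : ℕ} {σ τ : Perm (Fin n)} (h : SameWeakExc k σ τ) (i : Fin n) :
    τ⁻¹ i < i ↔ σ⁻¹ i < i := ⟨h.symm.inv_lt, h.inv_lt⟩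

theorem SameWeakExc.isCyclePeak_iff {k : ℕ} {σ τ : Perm (Fin n)} (h : SameWeakExc k σ τ)
    (i : Fin n) : IsCyclePeak τ i ↔ IsCyclePeak σ i := by
  rw [IsCyclePeak, IsCyclePeak, h.inv_lt_iff, h.lt_iff]

/-! ### The choices at an antiexcedance. -/

/-- The values below `i` that `σ` takes at positions not before `i`. -/
def availableValues (σ : Perm (Fin n)) (i : Fin n) : Finset (Fin n) :=
  Finset.univ.filter fun v => v < i ∧ i ≤ σ⁻¹ v

/-- The number of positions before `i` with value at least `i`. -/
def height (σ : Perm (Fin n)) (i : Fin n) : ℕ :=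
  (Finset.univ.filter fun j => j < i ∧ i ≤ σ j).card

/-- There are as many positions before `i` as values below `i`; removing the pairs `(j, σ j)` with
both entries below `i` leaves the two sides. -/
theorem card_availableValues (σ : Perm (Fin n)) (i : Fin n) :
    (availableValues σ i).card = height σ i := by
  have h1 : (Finset.univ.filter fun v => v < i).card =
      (availableValues σ i).card + (Finset.univ.filter fun v => v < i ∧ σ⁻¹ v < i).card := by
    rw [availableValues, ← Finset.card_filter_add_card_filter_not (s := Finset.univ.filter fun v => v < i)
      (fun v => i ≤ σ⁻¹ v)]
    simp only [Finset.filter_filter, not_le]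
  have h2 : (Finset.univ.filter fun v => v < i).card =
      height σ i + (Finset.univ.filter fun j => j < i ∧ σ j < i).card := by
    rw [height, ← Finset.card_filter_add_card_filter_not (s := Finset.univ.filter fun v => v < i)
      (fun v => i ≤ σ v)]
    simp only [Finset.filter_filter, not_le]
  have h3 : (Finset.univ.filter fun v => v < i ∧ σ⁻¹ v < i).card =
      (Finset.univ.filter fun j => j < i ∧ σ j < i).card := by
    refine Finset.card_equiv σ⁻¹ fun v => ?_
    simp [and_comm]
  omega

theorem SameWeakExc.height_eq {k : ℕ} {σ τ : Perm (Fin n)} (h : SameWeakExc k σ τ) (i : Fin n) :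
    height τ i = height σ i := by
  unfold height
  congr 1
  ext j
  simp only [Finset.mem_filter, Finset.mem_univ, true_and, and_congr_right_iff]
  intro hj
  constructor
  · intro hi; rwa [← h j (.inr (.inr (hj.le.trans hi)))]
  · intro hi; rwa [h j (.inr (.inl (hj.le.trans hi)))]

/-- `σ` with its values at `i` and at the position of `v` exchanged. -/
def exchange (σ : Perm (Fin n)) (i v : Fin n) : Perm (Fin n) := σ * swap i (σ⁻¹ v)

@[simp] theorem exchange_apply_self (σ : Perm (Fin n)) (i v : Fin n) : exchange σ i v i = v := by
  simp [exchange]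

theorem exchange_apply_of_lt {σ : Perm (Fin n)} {i v j : Fin n} (hv : v ∈ availableValues σ i)
    (hj : j < i) : exchange σ i v j = σ j := by
  simp only [availableValues, Finset.mem_filter, Finset.mem_univ, true_and] at hv
  rw [exchange, Perm.mul_apply, swap_apply_of_ne_of_ne hj.ne (hj.trans_le hv.2).ne]

/-- Both positions involved are at least `i` and hold values below `i` before and after the
exchange, so no weak excedance is created or destroyed. -/
theorem sameWeakExc_exchange {σ : Perm (Fin n)} {i v : Fin n} (hi : σ i < i)
    (hv : v ∈ availableValues σ i) : SameWeakExc i σ (exchange σ i v) := by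
  intro j hj
  have hv' := hv
  simp only [availableValues, Finset.mem_filter, Finset.mem_univ, true_and] at hv'
  by_cases hji : j = i
  · subst hji
    rcases hj with hj | hj | hj
    · exact absurd hj (lt_irrefl _)
    · exact absurd hi hj.not_gt
    · rw [exchange_apply_self] at hj
      exact absurd hv'.1 hj.not_gt
  by_cases hjv : j = σ⁻¹ v
  · subst hjv
    have h1 : exchange σ i v (σ⁻¹ v) = σ i := by simp [exchange]
    rcases hj with hj | hj | hj
    · exact absurd (show σ⁻¹ v < i from hj) hv'.2.not_gt
    · have : σ (σ⁻¹ v) = v := by simp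
      rw [this] at hj
      exact absurd (hv'.1.trans_le hv'.2) hj.not_gt
    · rw [h1] at hj
      exact absurd (hi.trans_le hv'.2) hj.not_gt
  · rw [exchange, Perm.mul_apply, swap_apply_of_ne_of_ne hji hjv]

theorem SameWeakExc.apply_mem_availableValues {σ τ : Perm (Fin n)} {i : Fin n}
    (h : SameWeakExc i σ τ) (hi : σ i < i) : τ i ∈ availableValues σ i := by
  simp only [availableValues, Finset.mem_filter, Finset.mem_univ, true_and]
  refine ⟨(h.lt_iff i).2 hi, not_lt.1 fun hlt => ?_⟩
  have := h (σ⁻¹ (τ i)) (.inl hlt)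
  rw [show σ (σ⁻¹ (τ i)) = τ i by simp] at this
  exact hlt.ne (τ.injective this)

/-- This splits a class according to the value at `i`, with `exchange σ i v` representing the piece
for `v`. -/
theorem sameWeakExc_succ_exchange_iff {σ τ : Perm (Fin n)} {i v : Fin n} (hi : σ i < i)
    (hv : v ∈ availableValues σ i) :
    SameWeakExc (i + 1) (exchange σ i v) τ ↔ SameWeakExc i σ τ ∧ τ i = v := by
  have hs := sameWeakExc_exchange hi hv
  constructor
  · intro h
    exact ⟨hs.trans (h.mono (Nat.le_succ _)), by simpa using h i (.inl (Nat.lt_succ_self _))⟩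
  · rintro ⟨h, hv'⟩ j hj
    by_cases hji : j = i
    · subst hji; simp [hv']
    · refine hs.symm.trans h j ?_
      rcases hj with hj | hj
      · exact .inl (lt_of_le_of_ne (Nat.lt_succ_iff.1 hj) fun h => hji (Fin.ext h))
      · exact .inr hj

theorem sameWeakExc_succ_iff {σ τ : Perm (Fin n)} {i : Fin n} (hi : i ≤ σ i) :
    SameWeakExc (i + 1) σ τ ↔ SameWeakExc i σ τ := by
  refine ⟨fun h => h.mono (Nat.le_succ _), fun h j hj => ?_⟩
  by_cases hji : j = i
  · subst hji; exact h j (.inr (.inl hi))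
  · refine h j ?_
    rcases hj with hj | hj
    · exact .inl (lt_of_le_of_ne (Nat.lt_succ_iff.1 hj) fun h => hji (Fin.ext h))
    · exact .inr hj

/-! ### Unique choices and their generating function. -/

/-- A property of cycle peaks `i` of a permutation that is determined by the values at positions
up to `i`, and that holds for exactly one choice of the value at `i`. -/
structure IsUniqueChoice (G : Fin n → Perm (Fin n) → Prop) : Prop where
  congr : ∀ {i : Fin n} {σ τ : Perm (Fin n)}, (∀ j ≤ i, σ j = τ j) → G i σ → G i τ
  existsUnique : ∀ {i : Fin n} {σ : Perm (Fin n)}, IsCyclePeak σ i →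
    ∃! v, v ∈ availableValues σ i ∧ G i (exchange σ i v)

/-- The factor contributed by position `i` to the generating function of a unique choice. -/
noncomputable def choiceFactor (σ : Perm (Fin n)) (i : Fin n) : ℕ[X] :=
  if σ i < i then (if σ⁻¹ i < i then ((height σ i - 1 : ℕ) : ℕ[X]) + X else (height σ i : ℕ[X]))
  else 1

theorem SameWeakExc.choiceFactor_eq {k : ℕ} {σ τ : Perm (Fin n)} (h : SameWeakExc k σ τ)
    (i : Fin n) : choiceFactor τ i = choiceFactor σ i := by
  simp only [choiceFactor, h.height_eq, h.lt_iff, h.inv_lt_iff]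

/-- The positions from `k` on. -/
def positionsFrom (n k : ℕ) : Finset (Fin n) := Finset.univ.filter fun j => k ≤ (j : ℕ)

theorem prod_positionsFrom {M : Type*} [CommMonoid M] (i : Fin n) (f : Fin n → M) :
    ∏ j ∈ positionsFrom n i, f j = f i * ∏ j ∈ positionsFrom n (i + 1), f j := by
  have : positionsFrom n i = insert i (positionsFrom n (i + 1)) := by
    ext j
    simp only [positionsFrom, Finset.mem_filter, Finset.mem_univ, true_and, Finset.mem_insert, Fin.ext_iff]
    omega
  rw [this, Finset.prod_insert (by simp [positionsFrom])]

open scoped Classical in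
/-- The weight of the positions from `k` on. -/
noncomputable def choiceWeight (G : Fin n → Perm (Fin n) → Prop) (k : ℕ) (τ : Perm (Fin n)) :
    ℕ[X] :=
  ∏ j ∈ positionsFrom n k, if IsCyclePeak τ j ∧ G j τ then X else 1

-- Whether `i` is a cycle peak does not depend on `v`. At a peak one of the `height σ i` choices
-- contributes `X` and the others `1`; elsewhere all contribute `1`.
open scoped Classical in
theorem sum_availableValues {G : Fin n → Perm (Fin n) → Prop} (hG : IsUniqueChoice G)
    {σ : Perm (Fin n)} {i : Fin n} (hi : σ i < i) :
    ∑ v ∈ availableValues σ i,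
      (if IsCyclePeak (exchange σ i v) i ∧ G i (exchange σ i v) then (X : ℕ[X]) else 1) =
      choiceFactor σ i := by
  have hp : ∀ v ∈ availableValues σ i,
      (IsCyclePeak (exchange σ i v) i ↔ IsCyclePeak σ i) := fun v hv =>
    (sameWeakExc_exchange hi hv).isCyclePeak_iff i
  by_cases hpk : σ⁻¹ i < i
  · obtain ⟨v, ⟨hv, hvG⟩, huniq⟩ := hG.existsUnique (i := i) (σ := σ) ⟨hpk, hi⟩
    rw [choiceFactor, if_pos hi, if_pos hpk, ← card_availableValues,
      ← Finset.card_erase_of_mem hv, ← Finset.sum_erase_add _ _ hv,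
      if_pos ⟨(hp v hv).2 ⟨hpk, hi⟩, hvG⟩]
    congr 1
    rw [Finset.sum_congr rfl (g := fun _ => 1), Finset.sum_const, nsmul_one]
    intro w hw
    rw [Finset.mem_erase] at hw
    exact if_neg fun h => hw.1 (huniq w ⟨hw.2, h.2⟩)
  · rw [choiceFactor, if_pos hi, if_neg hpk, ← card_availableValues,
      Finset.sum_congr rfl (g := fun _ => 1), Finset.sum_const, nsmul_one]
    intro w hw
    exact if_neg fun h => hpk ((hp w hw).1 h.1).1

/-- Induction on the number `m` of positions still free. The right side does not mention `G`, which
is what makes two unique choices comparable. -/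
theorem sum_choiceWeight {G : Fin n → Perm (Fin n) → Prop} (hG : IsUniqueChoice G) (m : ℕ) :
    ∀ k, k + m = n → ∀ σ : Perm (Fin n),
      ∑ τ with SameWeakExc k σ τ, choiceWeight G k τ =
        ∏ j ∈ positionsFrom n k, choiceFactor σ j := by
  classical
  induction m with
  | zero =>
    intro k hk σ
    have hemp : positionsFrom n k = ∅ := by
      ext j; simp [positionsFrom]; omega
    have hs : (Finset.univ.filter fun τ : Perm (Fin n) => SameWeakExc k σ τ) = {σ} := by
      ext τ
      simp only [Finset.mem_filter, Finset.mem_univ, true_and, Finset.mem_singleton]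
      constructor
      · intro h; ext1 j; exact h j (.inl (by omega))
      · rintro rfl j _; rfl
    simp [choiceWeight, hemp, hs]
  | succ m ih =>
    intro k hk σ
    obtain ⟨i, rfl⟩ : ∃ i : Fin n, (i : ℕ) = k := ⟨⟨k, by omega⟩, rfl⟩
    rw [prod_positionsFrom]
    have hw : ∀ τ, choiceWeight G i τ =
        (if IsCyclePeak τ i ∧ G i τ then X else 1) * choiceWeight G (i + 1) τ := fun τ =>
      prod_positionsFrom i _
    by_cases hi : σ i < i
    · rw [← Finset.sum_fiberwise_of_maps_to (t := availableValues σ i) (g := fun τ => τ i)]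
      · rw [← sum_availableValues hG hi, Finset.sum_mul]
        refine Finset.sum_congr rfl fun v hv => ?_
        have hs := sameWeakExc_exchange hi hv
        -- The later factors are constant on the class, so they may be computed from the
        -- representative `exchange σ i v`.
        rw [← Finset.prod_congr rfl fun j _ => hs.choiceFactor_eq j, ← ih (i + 1) (by omega),
          Finset.mul_sum, Finset.filter_filter]
        simp only [← sameWeakExc_succ_exchange_iff hi hv]
        refine Finset.sum_congr rfl fun τ hτ => ?_
        replace hτ := (Finset.mem_filter.1 hτ).2
        have hag : ∀ j ≤ i, τ j = exchange σ i v j := fun j hj =>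
          hτ j (.inl (Nat.lt_succ_iff.2 hj))
        have hGi : G i τ ↔ G i (exchange σ i v) :=
          ⟨hG.congr hag, hG.congr fun j hj => (hag j hj).symm⟩
        simp only [hw, hτ.isCyclePeak_iff, hGi]
      · intro τ hτ
        exact ((Finset.mem_filter.1 hτ).2).apply_mem_availableValues hi
    · rw [choiceFactor, if_neg hi, one_mul, ← ih (i + 1) (by omega)]
      simp only [sameWeakExc_succ_iff (not_lt.1 hi)]
      refine Finset.sum_congr rfl fun τ hτ => ?_
      replace hτ := (Finset.mem_filter.1 hτ).2
      rw [hw, if_neg, one_mul]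
      rintro ⟨⟨-, h⟩, -⟩
      exact hi ((hτ.lt_iff i).1 h)

theorem choiceWeight_zero (G : Fin n → Perm (Fin n) → Prop) [∀ i σ, Decidable (G i σ)]
    (τ : Perm (Fin n)) :
    choiceWeight G 0 τ = X ^ (Finset.univ.filter fun i => IsCyclePeak τ i ∧ G i τ).card := by
  classical
  simp only [choiceWeight, positionsFrom, Nat.zero_le, Finset.filter_true]
  rw [← Finset.prod_const, Finset.prod_filter]
  congr!

theorem card_filter_eq_coeff {α : Type*} (S : Finset α) (s : α → ℕ) (l : ℕ) :
    (S.filter fun a => s a = l).card = (∑ a ∈ S, (X : ℕ[X]) ^ s a).coeff l := by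
  simp only [finsetSum_coeff, coeff_X_pow, Finset.card_filter, eq_comm]

/-- Presents the classes as fibres of a map, so that counts can be summed class by class. -/
theorem sameWeakExc_zero_iff {σ τ : Perm (Fin n)} : SameWeakExc 0 σ τ ↔
    (fun j => if j ≤ τ j then some (τ j) else none) =
      (fun j => if j ≤ σ j then some (σ j) else none) := by
  rw [funext_iff]
  refine forall_congr' fun j => ?_
  by_cases h1 : j ≤ σ j <;> by_cases h2 : j ≤ τ j <;> simp [h1, h2]
  · intro h; exact h2 (h ▸ h1)
  · intro h; exact h1 (h ▸ h2)

theorem equidistributed_of_isUniqueChoice {G G' : Fin n → Perm (Fin n) → Prop}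
    [∀ i σ, Decidable (G i σ)] [∀ i σ, Decidable (G' i σ)]
    (hG : IsUniqueChoice G) (hG' : IsUniqueChoice G') (e : Perm (Fin n) → ℕ)
    (he : ∀ σ τ, SameWeakExc 0 σ τ → e τ = e σ) :
    Equidistributed n
      (fun σ => (e σ, (Finset.univ.filter fun i => IsCyclePeak σ i ∧ G i σ).card))
      (fun σ => (e σ, (Finset.univ.filter fun i => IsCyclePeak σ i ∧ G' i σ).card)) := by
  classical
  rintro ⟨k, l⟩
  let w : Perm (Fin n) → Fin n → Option (Fin n) := fun τ j => if j ≤ τ j then some (τ j) else none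
  rw [Finset.card_eq_sum_card_fiberwise (f := w) (t := Finset.univ.image w)
      (fun a _ => Finset.mem_coe.2 (Finset.mem_image_of_mem _ (Finset.mem_univ a))),
    Finset.card_eq_sum_card_fiberwise (f := w) (t := Finset.univ.image w)
      (fun a _ => Finset.mem_coe.2 (Finset.mem_image_of_mem _ (Finset.mem_univ a)))]
  refine Finset.sum_congr rfl fun a ha => ?_
  obtain ⟨σ, -, rfl⟩ := Finset.mem_image.1 ha
  have key : ∀ s : Perm (Fin n) → ℕ,
      ((Finset.univ.filter fun τ => (e τ, s τ) = (k, l)).filter fun τ => w τ = w σ).card =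
        if e σ = k then (∑ τ with SameWeakExc 0 σ τ, (X : ℕ[X]) ^ s τ).coeff l else 0 := by
    intro s
    rw [← card_filter_eq_coeff]
    split_ifs with h
    · congr 1
      ext τ
      simp only [Finset.mem_filter, Finset.mem_univ, true_and, Prod.mk.injEq]
      rw [show (w τ = w σ) ↔ SameWeakExc 0 σ τ from sameWeakExc_zero_iff.symm]
      constructor
      · rintro ⟨⟨_, h1⟩, h2⟩; exact ⟨h2, h1⟩
      · rintro ⟨h2, h1⟩; exact ⟨⟨(he _ _ h2).trans h, h1⟩, h2⟩
    · rw [Finset.card_eq_zero, Finset.eq_empty_iff_forall_notMem]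
      intro τ hτ
      simp only [Finset.mem_filter, Finset.mem_univ, true_and, Prod.mk.injEq] at hτ
      exact h ((he _ _ (sameWeakExc_zero_iff.2 hτ.2)).symm.trans hτ.1.1)
  rw [key, key]
  simp only [← choiceWeight_zero]
  rw [sum_choiceWeight hG n 0 (by omega), sum_choiceWeight hG' n 0 (by omega)]

/-! ### Three unique choices: least value, greatest value, cycle maximum. -/

theorem mem_availableValues {σ : Perm (Fin n)} {i v : Fin n} :
    v ∈ availableValues σ i ↔ v < i ∧ i ≤ σ⁻¹ v := by simp [availableValues]

theorem IsCyclePeak.apply_mem {σ : Perm (Fin n)} {i : Fin n} (h : IsCyclePeak σ i) :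
    σ i ∈ availableValues σ i := mem_availableValues.2 ⟨h.2, by simp⟩

theorem exchange_inv_apply {σ : Perm (Fin n)} {i v w : Fin n} (hv : v ∈ availableValues σ i)
    (hw : σ⁻¹ w < i) : (exchange σ i v)⁻¹ w = σ⁻¹ w := by
  rw [Perm.inv_eq_iff_eq, exchange_apply_of_lt hv hw]; simp

theorem exchange_inv_lt_iff {σ : Perm (Fin n)} {i v w : Fin n} (hv : v ∈ availableValues σ i) :
    (exchange σ i v)⁻¹ w < i ↔ σ⁻¹ w < i := by
  refine ⟨fun h => ?_, fun h => by rwa [exchange_inv_apply hv h]⟩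
  have := exchange_apply_of_lt hv h
  rw [show exchange σ i v ((exchange σ i v)⁻¹ w) = w by simp] at this
  rwa [Perm.inv_eq_iff_eq.2 this]

theorem inv_lt_of_agree {σ τ : Perm (Fin n)} {i w : Fin n} (h : ∀ j ≤ i, σ j = τ j)
    (hw : σ⁻¹ w < i) : τ⁻¹ w < i := by
  have := h _ hw.le
  rw [show σ (σ⁻¹ w) = w by simp] at this
  rwa [Perm.inv_eq_iff_eq.2 this]

/-- All values below `σ i` stand before position `i`. -/
def TakesLeast (i : Fin n) (σ : Perm (Fin n)) : Prop := ∀ v < σ i, σ⁻¹ v < i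

/-- All values strictly between `σ i` and `i` stand before position `i`. -/
def TakesGreatest (i : Fin n) (σ : Perm (Fin n)) : Prop := ∀ v, σ i < v → v < i → σ⁻¹ v < i

/-- `i` is the greatest element of its cycle. -/
def IsCycleMax (i : Fin n) (σ : Perm (Fin n)) : Prop := ∀ j, σ.SameCycle i j → j ≤ i

instance (i : Fin n) (σ : Perm (Fin n)) : Decidable (TakesLeast i σ) :=
  inferInstanceAs (Decidable (∀ v < σ i, σ⁻¹ v < i))

instance (i : Fin n) (σ : Perm (Fin n)) : Decidable (TakesGreatest i σ) :=
  inferInstanceAs (Decidable (∀ v, σ i < v → v < i → σ⁻¹ v < i))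

instance (i : Fin n) (σ : Perm (Fin n)) : Decidable (IsCycleMax i σ) :=
  inferInstanceAs (Decidable (∀ j, σ.SameCycle i j → j ≤ i))

theorem isUniqueChoice_takesLeast : IsUniqueChoice (TakesLeast (n := n)) where
  congr := fun {i σ τ} h hσ v hv => inv_lt_of_agree h (hσ v (h i le_rfl ▸ hv))
  existsUnique := by
    intro i σ hi
    have hne : (availableValues σ i).Nonempty := ⟨_, hi.apply_mem⟩
    refine ⟨(availableValues σ i).min' hne, ⟨Finset.min'_mem _ _, ?_⟩, ?_⟩
    · intro v hv
      rw [exchange_apply_self] at hv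
      rw [exchange_inv_lt_iff (Finset.min'_mem _ _)]
      by_contra hcon
      have hm := mem_availableValues.1 (Finset.min'_mem _ hne)
      exact (Finset.min'_le _ v (mem_availableValues.2 ⟨hv.trans hm.1, not_lt.1 hcon⟩)).not_gt hv
    · rintro v ⟨hv, hG⟩
      refine le_antisymm (not_lt.1 fun hlt => ?_) (Finset.min'_le _ _ hv)
      have := hG _ (by rwa [exchange_apply_self])
      rw [exchange_inv_lt_iff hv] at this
      exact (mem_availableValues.1 (Finset.min'_mem _ hne)).2.not_gt this

theorem isUniqueChoice_takesGreatest : IsUniqueChoice (TakesGreatest (n := n)) where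
  congr := fun {i σ τ} h hσ v hv hvi => inv_lt_of_agree h (hσ v ((h i le_rfl).symm ▸ hv) hvi)
  existsUnique := by
    intro i σ hi
    have hne : (availableValues σ i).Nonempty := ⟨_, hi.apply_mem⟩
    refine ⟨(availableValues σ i).max' hne, ⟨Finset.max'_mem _ _, ?_⟩, ?_⟩
    · intro v hv hvi
      rw [exchange_apply_self] at hv
      rw [exchange_inv_lt_iff (Finset.max'_mem _ _)]
      by_contra hcon
      exact (Finset.le_max' _ v (mem_availableValues.2 ⟨hvi, not_lt.1 hcon⟩)).not_gt hv
    · rintro v ⟨hv, hG⟩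
      refine le_antisymm (Finset.le_max' _ _ hv) (not_lt.1 fun hlt => ?_)
      have hm := mem_availableValues.1 (Finset.max'_mem _ hne)
      have := hG _ (by rwa [exchange_apply_self]) hm.1
      rw [exchange_inv_lt_iff hv] at this
      exact hm.2.not_gt this

/-- Go backwards from `i` along its cycle until the next preimage would be at least `i`, and let `w`
be the last point reached. The path to `w` uses only positions before `i`, hence is the same for
every choice at `i`. Choosing `w` closes the cycle; any other choice puts a point greater than `i`
into it. -/
theorem isUniqueChoice_isCycleMax : IsUniqueChoice (IsCycleMax (n := n)) where
  congr := by
    intro i σ τ h hσ j hj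
    -- The cycle of `i` under `σ` stays within positions up to `i`, where the two permutations
    -- agree.
    have key : ∀ m : ℕ, (σ ^ m) i = (τ ^ m) i := by
      intro m
      induction m with
      | zero => rfl
      | succ m ih =>
        rw [pow_succ', pow_succ', Perm.mul_apply, Perm.mul_apply, ← ih]
        exact h _ (hσ _ ⟨m, by simp⟩)
    obtain ⟨m, rfl⟩ := hj.exists_nat_pow_eq
    rw [← key]
    exact hσ _ ⟨m, by simp⟩
  existsUnique := by
    intro i σ hi
    have hex : ∃ m : ℕ, i ≤ (σ⁻¹ ^ (m + 1)) i := by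
      refine ⟨orderOf σ⁻¹ - 1, ?_⟩
      rw [Nat.sub_add_cancel (orderOf_pos _), pow_orderOf_eq_one]; simp
    obtain ⟨N, hN, hmin⟩ : ∃ N : ℕ, i ≤ (σ⁻¹ ^ (N + 1)) i ∧
        ∀ m < N, (σ⁻¹ ^ (m + 1)) i < i :=
      ⟨Nat.find hex, Nat.find_spec hex, fun m hm => not_le.1 (Nat.find_min hex hm)⟩
    have hpath : ∀ v ∈ availableValues σ i, ∀ m ≤ N,
        ((exchange σ i v)⁻¹ ^ m) i = (σ⁻¹ ^ m) i := by
      intro v hv m hm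
      induction m with
      | zero => rfl
      | succ m ih =>
        have := hmin m hm
        rw [pow_succ', Perm.mul_apply] at this
        rw [pow_succ', pow_succ', Perm.mul_apply, Perm.mul_apply, ih (by omega),
          exchange_inv_apply hv this]
    have hle : ∀ m ≤ N, (σ⁻¹ ^ m) i ≤ i := by
      rintro (_ | m) hm
      · simp
      · exact (hmin m hm).le
    obtain ⟨M, rfl⟩ : ∃ M, N = M + 1 := by
      cases N with
      | zero => exact absurd hi.1 (by simpa using hN)
      | succ M => exact ⟨M, rfl⟩
    have hv : (σ⁻¹ ^ (M + 1)) i ∈ availableValues σ i := by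
      refine mem_availableValues.2 ⟨hmin M (Nat.lt_succ_self _), ?_⟩
      rwa [pow_succ', Perm.mul_apply] at hN
    refine ⟨(σ⁻¹ ^ (M + 1)) i, ⟨hv, ?_⟩, ?_⟩
    · set τ := exchange σ i ((σ⁻¹ ^ (M + 1)) i) with hτ
      have hclose : (τ⁻¹ ^ (M + 2)) i = i := by
        rw [pow_succ', Perm.mul_apply, hpath _ hv _ le_rfl, Perm.inv_eq_iff_eq,
          exchange_apply_self]
      intro j hj
      obtain ⟨m, rfl⟩ := (sameCycle_inv.2 hj).exists_nat_pow_eq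
      have : ∀ m : ℕ, ∃ l ≤ M + 1, (τ⁻¹ ^ m) i = (τ⁻¹ ^ l) i := by
        intro m
        induction m with
        | zero => exact ⟨0, by omega, rfl⟩
        | succ m ih =>
          obtain ⟨l, hl, h⟩ := ih
          rcases hl.eq_or_lt with rfl | hl
          · refine ⟨0, by omega, ?_⟩
            rw [pow_succ', Perm.mul_apply, h, ← Perm.mul_apply, ← pow_succ', hclose]; rfl
          · exact ⟨l + 1, hl, by rw [pow_succ', Perm.mul_apply, h, ← Perm.mul_apply, ← pow_succ']⟩
      obtain ⟨l, hl, h⟩ := this m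
      rw [h, hpath _ hv _ hl]
      exact hle l hl
    · rintro v ⟨hv', hG⟩
      by_contra hne
      -- The preimage of the last path point is at least `i`; if `i` is the cycle maximum it equals
      -- `i`, whose value is `v`.
      have h1 := hG _ (sameCycle_inv.1 ⟨(M + 2 : ℕ), rfl⟩)
      rw [zpow_natCast, pow_succ', Perm.mul_apply, hpath _ hv' _ le_rfl] at h1
      have h2 := mem_availableValues.1 hv
      have h3 : i ≤ (exchange σ i v)⁻¹ ((σ⁻¹ ^ (M + 1)) i) :=
        not_lt.1 fun h => h2.2.not_gt ((exchange_inv_lt_iff hv').1 h)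
      have h4 := Perm.inv_eq_iff_eq.1 (le_antisymm h1 h3)
      rw [exchange_apply_self] at h4
      exact hne h4.symm

/-! ### The statistics as numbers of marked cycle peaks. -/

theorem ear_eq (σ : Perm (Fin n)) :
    ear σ = (Finset.univ.filter fun i => IsCyclePeak σ i ∧ TakesLeast i σ).card := by
  unfold ear
  congr 1
  ext i
  simp only [Finset.mem_filter, Finset.mem_univ, true_and, IsEar, IsExclusiveAntirecord]
  rw [and_comm, and_congr_right_iff]
  intro hi
  have hiff : IsAntirecord σ i ↔ TakesLeast i σ := by
    constructor
    · intro h v hv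
      rcases lt_trichotomy (σ⁻¹ v) i with h1 | h1 | h1
      · exact h1
      · rw [Perm.inv_eq_iff_eq] at h1; exact absurd hv (h1 ▸ lt_irrefl _)
      · exact absurd (h _ h1) (by simpa using hv.le)
    · intro h j hj
      refine lt_of_le_of_ne (not_lt.1 fun hlt => ?_) fun he => hj.ne (σ.injective he)
      have := h _ hlt
      rw [show σ⁻¹ (σ j) = j by simp] at this
      exact this.not_gt hj
  rw [hiff, and_iff_left_iff_imp]
  intro _ hrec
  -- At a record all values standing before `i` lie below `σ i`, which forces `i ≤ σ i`; so a cycle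
  -- peak is never a record.
  have h1 : (Finset.Iio i).map σ.toEmbedding ⊆ Finset.Iio (σ i) := by
    intro x hx
    simp only [Finset.mem_map_equiv, Finset.mem_Iio] at hx
    simpa using hrec _ hx
  have h2 := Finset.card_le_card h1
  rw [Finset.card_map, Fin.card_Iio, Fin.card_Iio] at h2
  exact h2.not_gt hi.2

theorem cyc_eq (σ : Perm (Fin n)) :
    cyc σ = (Finset.univ.filter fun i => IsCycleMax i σ).card := by
  unfold cyc
  symm
  refine Finset.card_nbij (fun i => Quotient.mk (SameCycle.setoid σ) i) ?_ ?_ ?_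
  · intro i _
    exact Finset.mem_image_of_mem _ (Finset.mem_univ i)
  · intro i hi j hj hij
    simp only [Finset.coe_filter, Finset.mem_univ, true_and, Set.mem_ofPred_eq] at hi hj
    have h : σ.SameCycle i j := Quotient.exact hij
    exact le_antisymm (hj _ h.symm) (hi _ h)
  · intro q _
    induction q using Quotient.inductionOn with
    | h i =>
      have hne : (Finset.univ.filter fun j => σ.SameCycle i j).Nonempty :=
        ⟨i, Finset.mem_filter.2 ⟨Finset.mem_univ _, SameCycle.refl _ _⟩⟩
      have hm := (Finset.mem_filter.1 (Finset.max'_mem _ hne)).2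
      refine ⟨_, ?_, Quotient.sound hm.symm⟩
      simp only [Finset.coe_filter, Finset.mem_univ, true_and, Set.mem_ofPred_eq]
      intro j hj
      exact Finset.le_max' _ _ (by simpa using hm.trans hj)

theorem pcyc_eq_card_ne (σ : Perm (Fin n)) :
    pcyc σ = (Finset.univ.filter fun i => σ i ≠ i ∧ IsCycleMax i σ).card := by
  rw [pcyc, cyc_eq, fix, ← Finset.card_filter_add_card_filter_not
    (s := Finset.univ.filter fun i => IsCycleMax i σ) (fun i => σ i = i),
    Finset.filter_filter, Finset.filter_filter]
  have : (Finset.univ.filter fun i => IsCycleMax i σ ∧ σ i = i) =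
      Finset.univ.filter fun i => σ i = i := by
    ext i
    simp only [Finset.mem_filter, Finset.mem_univ, true_and, and_iff_right_iff_imp]
    intro h j hj
    exact (hj.eq_of_left h).ge
  rw [this, Nat.add_sub_cancel_left]
  simp only [and_comm, ne_eq]

theorem pcyc_eq (σ : Perm (Fin n)) :
    pcyc σ = (Finset.univ.filter fun i => IsCyclePeak σ i ∧ IsCycleMax i σ).card := by
  rw [pcyc_eq_card_ne]
  congr 1
  ext i
  simp only [Finset.mem_filter, Finset.mem_univ, true_and, and_congr_left_iff]
  intro hm
  constructor
  · intro h
    refine ⟨lt_of_le_of_ne (hm _ ⟨-1, by simp⟩) ?_, lt_of_le_of_ne (hm _ ⟨1, by simp⟩) h⟩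
    rw [Ne, Perm.inv_eq_iff_eq]; exact fun h' => h h'.symm
  · intro h; exact h.2.ne

/-- Number of antiexcedances. -/
def aexc (σ : Perm (Fin n)) : ℕ := (Finset.univ.filter fun i => σ i < i).card

theorem SameWeakExc.exc_eq {k : ℕ} {σ τ : Perm (Fin n)} (h : SameWeakExc k σ τ) :
    exc τ = exc σ := by
  unfold exc
  congr 1
  ext i
  simp only [Finset.mem_filter, Finset.mem_univ, true_and, IsExcedance]
  constructor
  · intro hi; rwa [← h i (.inr (.inr hi.le))]
  · intro hi; rwa [h i (.inr (.inl hi.le))]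

theorem SameWeakExc.aexc_eq {k : ℕ} {σ τ : Perm (Fin n)} (h : SameWeakExc k σ τ) :
    aexc τ = aexc σ := by simp only [aexc, h.lt_iff]

theorem aexc_inv (σ : Perm (Fin n)) : aexc σ⁻¹ = exc σ := by
  refine Finset.card_equiv σ⁻¹ fun i => ?_
  simp [IsExcedance]

theorem pcyc_inv (σ : Perm (Fin n)) : pcyc σ⁻¹ = pcyc σ := by
  rw [pcyc_eq_card_ne, pcyc_eq_card_ne]
  congr 1
  ext i
  rw [Finset.mem_filter_univ, Finset.mem_filter_univ]
  simp only [IsCycleMax, sameCycle_inv, and_congr_left_iff]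
  rintro -
  rw [Ne, Perm.inv_eq_iff_eq, eq_comm]

theorem aexc_revPerm_conj (σ : Perm (Fin n)) :
    aexc (Fin.revPerm.permCongr σ) = exc σ := by
  refine Finset.card_equiv Fin.revPerm fun i => ?_
  simp [IsExcedance, Fin.rev_lt_iff]

/-- Purity concerns the values in `[i, σ i]`. Excluding the value `i` itself becomes the cycle peak
condition, excluding the values strictly between becomes `TakesGreatest`, and `σ i` is excluded by
injectivity. -/
theorem pex_eq_revPerm_conj (σ : Perm (Fin n)) :
    (Finset.univ.filter fun i => IsCyclePeak (Fin.revPerm.permCongr σ) i ∧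
      TakesGreatest i (Fin.revPerm.permCongr σ)).card = pex σ := by
  refine Finset.card_equiv Fin.revPerm fun i => ?_
  have hinv : ∀ x, (Fin.revPerm.permCongr σ)⁻¹ x = (σ⁻¹ x.rev).rev := by
    intro x; rw [Perm.inv_eq_iff_eq]; simp
  simp only [Finset.mem_filter, Finset.mem_univ, true_and, IsPureExcedance, IsExcedance,
    IsCyclePeak, TakesGreatest, hinv, Equiv.permCongr_apply, Fin.revPerm_apply, Fin.revPerm_symm,
    Finset.mem_Icc, not_and, not_le]
  obtain ⟨i, rfl⟩ := Fin.rev_surjective i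
  simp only [Fin.rev_rev, Fin.rev_lt_rev]
  constructor
  · rintro ⟨⟨h1, h2⟩, h3⟩
    refine ⟨h2, fun j hj hle => ?_⟩
    by_contra hcon
    rw [not_lt] at hcon
    have hne : σ j ≠ σ i := fun h => hj.ne (σ.injective h)
    rcases hle.eq_or_lt with he | hlt
    · rw [Perm.inv_eq_iff_eq.2 he] at h1
      exact h1.not_gt hj
    · have := h3 (σ j).rev (by simpa using lt_of_le_of_ne hcon hne) (by simpa using hlt)
      rw [Fin.rev_rev, show σ⁻¹ (σ j) = j by simp] at this
      exact this.not_gt hj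
  · rintro ⟨h2, h3⟩
    refine ⟨⟨?_, h2⟩, fun v hv hvi => ?_⟩
    · rcases lt_trichotomy (σ⁻¹ i) i with h | h | h
      · exact absurd (h3 _ h (by simp)) (by simpa using h2.le)
      · rw [Perm.inv_eq_iff_eq] at h; exact absurd h2 (by rw [← h]; exact lt_irrefl _)
      · exact h
    · obtain ⟨v, rfl⟩ := Fin.rev_surjective v
      simp only [Fin.rev_rev, Fin.rev_lt_rev] at hv hvi ⊢
      rcases lt_trichotomy (σ⁻¹ v) i with h | h | h
      · exact absurd (h3 _ h (by simpa using hvi.le)) (by simpa using hv.le)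
      · rw [Perm.inv_eq_iff_eq] at h; exact absurd hv (h ▸ lt_irrefl _)
      · exact h

theorem Equidistributed.symm {s t : Perm (Fin n) → ℕ × ℕ} (h : Equidistributed n s t) :
    Equidistributed n t s := fun p => (h p).symm

theorem Equidistributed.trans {s t u : Perm (Fin n) → ℕ × ℕ} (h : Equidistributed n s t)
    (h' : Equidistributed n t u) : Equidistributed n s u := fun p => (h p).trans (h' p)

theorem equidistributed_comp (e : Perm (Fin n) ≃ Perm (Fin n)) (s : Perm (Fin n) → ℕ × ℕ) :
    Equidistributed n (fun σ => s (e σ)) s := fun p => by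
  refine Finset.card_equiv e fun σ => ?_
  simp

theorem equidistributed_exc_pcyc_exc_ear (n : ℕ) :
    Equidistributed n (fun σ => (exc σ, pcyc σ)) (fun σ => (exc σ, ear σ)) := by
  simp only [pcyc_eq, ear_eq]
  exact equidistributed_of_isUniqueChoice isUniqueChoice_isCycleMax isUniqueChoice_takesLeast exc
    fun _ _ h => h.exc_eq

theorem equidistributed_exc_pcyc_exc_pex (n : ℕ) :
    Equidistributed n (fun σ => (exc σ, pcyc σ)) (fun σ => (exc σ, pex σ)) := by
  have h1 := equidistributed_comp (n := n) (Equiv.inv _) fun σ => (aexc σ, pcyc σ)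
  simp only [Equiv.inv_apply, aexc_inv, pcyc_inv] at h1
  have h2 := equidistributed_comp (n := n) (Fin.revPerm.permCongr) fun σ => (aexc σ,
    (Finset.univ.filter fun i => IsCyclePeak σ i ∧ TakesGreatest i σ).card)
  simp only [aexc_revPerm_conj, pex_eq_revPerm_conj] at h2
  refine (h1.trans ?_).trans h2.symm
  simp only [pcyc_eq]
  exact equidistributed_of_isUniqueChoice isUniqueChoice_isCycleMax isUniqueChoice_takesGreatest
    aexc fun _ _ h => h.aexc_eq

/-! ### The common recursion. -/

/-- The recursion for a triple of statistics whose values change from `(a, b, r)` as follows under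
the `n + 1` ways of inserting a further element: once to `(a, b, r + 1)`, `a` times not at all,
`r` times to `(a + 1, b + 1, r - 1)`, and otherwise to `(a + 1, b, r)`. -/
def insertionStep (n : ℕ) (f : ℕ × ℕ × ℕ → ℕ) (x : ℕ × ℕ × ℕ) : ℕ :=
  f (x.1, x.2.1, x.2.2 + 1) + (x.1 * f x + (x.2.2 * f (x.1 + 1, x.2.1 + 1, x.2.2 - 1) +
    (n - x.1 - x.2.2) * f (x.1 + 1, x.2.1, x.2.2)))

/-- Quantifying over all test functions `f` closes the induction, since `insertionStep n f` is again
one. -/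
theorem sum_eq_sum_of_insertionStep (s t : ∀ n, Perm (Fin n) → ℕ × ℕ × ℕ)
    (h0 : s 0 1 = t 0 1)
    (hs : ∀ n f, ∑ σ, f (s (n + 1) σ) = ∑ σ, insertionStep n f (s n σ))
    (ht : ∀ n f, ∑ σ, f (t (n + 1) σ) = ∑ σ, insertionStep n f (t n σ)) (n : ℕ) :
    ∀ f : ℕ × ℕ × ℕ → ℕ, ∑ σ, f (s n σ) = ∑ σ, f (t n σ) := by
  induction n with
  | zero =>
    intro f
    refine Finset.sum_congr rfl fun σ _ => ?_
    rw [Subsingleton.elim σ 1, h0]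
  | succ n ih => intro f; rw [hs, ht, ih]

theorem insertionStep_eq_sum (D R : Fin n → Prop) [DecidablePred D] [DecidablePred R]
    (hDR : ∀ q, D q → ¬ R q) (f : ℕ × ℕ × ℕ → ℕ) (x : ℕ × ℕ × ℕ)
    (hD : (Finset.univ.filter D).card = x.1) (hR : (Finset.univ.filter R).card = x.2.2) :
    insertionStep n f x = f (x.1, x.2.1, x.2.2 + 1) +
      ∑ q, if D q then f x else if R q then f (x.1 + 1, x.2.1 + 1, x.2.2 - 1)
        else f (x.1 + 1, x.2.1, x.2.2) := by
  -- Disjointness of `D` and `R` also keeps the subtraction `n - x.1 - x.2.2` from being truncated.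
  have h1 : (Finset.univ.filter fun q => ¬ D q ∧ R q) = Finset.univ.filter R := by
    ext q
    simp only [Finset.mem_filter, Finset.mem_univ, true_and]
    exact ⟨fun h => h.2, fun h => ⟨fun hd => hDR q hd h, h⟩⟩
  have h2 := Finset.card_filter_add_card_filter_not (s := (Finset.univ : Finset (Fin n))) D
  have h3 := Finset.card_filter_add_card_filter_not
    (s := (Finset.univ : Finset (Fin n)).filter fun q => ¬ D q) R
  rw [Finset.filter_filter, Finset.filter_filter, h1] at h3
  rw [Finset.card_fin] at h2
  rw [insertionStep, Finset.sum_ite, Finset.sum_ite, Finset.sum_const, Finset.sum_const,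
    Finset.sum_const, Finset.filter_filter, Finset.filter_filter, h1, hD, hR,
    show (Finset.univ.filter fun q => ¬ D q ∧ ¬ R q).card = n - x.1 - x.2.2 by omega]
  simp only [smul_eq_mul]

theorem card_filter_eq_or {α : Type*} [Fintype α] [DecidableEq α] {P : α → Prop}
    [DecidablePred P] {q : α} (hq : ¬ P q) :
    (Finset.univ.filter fun j => j = q ∨ P j).card = (Finset.univ.filter P).card + 1 := by
  rw [← Finset.card_insert_of_notMem (a := q) (by simpa using hq)]
  congr 1
  ext j; simp

theorem card_filter_ne_and {α : Type*} [Fintype α] [DecidableEq α] {P : α → Prop}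
    [DecidablePred P] {q : α} (hq : P q) :
    (Finset.univ.filter fun j => j ≠ q ∧ P j).card = (Finset.univ.filter P).card - 1 := by
  rw [← Finset.card_erase_of_mem (a := q) (by simpa using hq)]
  congr 1
  ext j; simp

theorem card_filter_succAbove (P : Fin (n + 1) → Prop) [DecidablePred P] (p : Fin (n + 1)) :
    (Finset.univ.filter P).card =
      (if P p then 1 else 0) + (Finset.univ.filter fun j => P (p.succAbove j)).card := by
  rw [Finset.card_filter, Fin.sum_univ_succAbove _ p, Finset.card_filter]

/-! ### Inserting a least value into the word: descents. -/

/-- The permutation with value `0` at position `p` and, elsewhere, the values of `σ` in their order,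
raised by `1`. -/
def insertZero (p : Fin (n + 1)) (σ : Perm (Fin n)) : Perm (Fin (n + 1)) :=
  (finSuccEquiv' p).trans ((optionCongr σ).trans (finSuccEquiv' 0).symm)

@[simp] theorem insertZero_apply_self (p : Fin (n + 1)) (σ : Perm (Fin n)) :
    insertZero p σ p = 0 := by simp [insertZero]

@[simp] theorem insertZero_apply_succAbove (p : Fin (n + 1)) (σ : Perm (Fin n)) (j : Fin n) :
    insertZero p σ (p.succAbove j) = (σ j).succ := by simp [insertZero]

theorem insertZero_bijective :
    Function.Bijective fun x : Fin (n + 1) × Perm (Fin n) => insertZero x.1 x.2 := by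
  rw [Fintype.bijective_iff_injective_and_card]
  refine ⟨?_, by simp [Fintype.card_perm, Nat.factorial_succ]⟩
  rintro ⟨p, σ⟩ ⟨p', σ'⟩ h
  simp only at h
  have hp : p = p' := by
    apply (insertZero p' σ').injective
    rw [insertZero_apply_self, ← h, insertZero_apply_self]
  subst hp
  congr 1
  ext1 j
  have := DFunLike.congr_fun h (p.succAbove j)
  simpa using this

theorem isDescent_insertZero_self (p : Fin (n + 1)) (σ : Perm (Fin n)) :
    ¬ IsDescent (insertZero p σ) p := by
  rintro ⟨h, h'⟩
  simp at h'

theorem isDescent_insertZero_succAbove (p : Fin (n + 1)) (σ : Perm (Fin n)) (j : Fin n) :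
    IsDescent (insertZero p σ) (p.succAbove j) ↔ p = j.succ ∨ IsDescent σ j := by
  have hnext : ∀ (h : (p.succAbove j : ℕ) + 1 < n + 1), p ≠ j.succ → ∃ h' : (j : ℕ) + 1 < n,
      (⟨(p.succAbove j : ℕ) + 1, h⟩ : Fin (n + 1)) = p.succAbove ⟨j + 1, h'⟩ := by
    intro h hp
    rw [Ne, Fin.ext_iff, Fin.val_succ] at hp
    simp only [Fin.succAbove, Fin.lt_def, Fin.ext_iff] at h ⊢
    have := p.isLt
    have := j.isLt
    by_cases hj : (j : ℕ) < p
    · simp [hj] at h ⊢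
      have : (j : ℕ) + 1 < p := by omega
      simp [this]; omega
    · simp [hj] at h ⊢
      have : ¬ (j : ℕ) + 1 < p := by omega
      simp [this]; omega
  by_cases hp : p = j.succ
  · simp only [hp, true_or, iff_true]
    have hs : (j.succ.succAbove j : ℕ) = j := by simp
    have hj : (j.succ.succAbove j : ℕ) + 1 < n + 1 := by rw [hs]; omega
    have he : (⟨(j.succ.succAbove j : ℕ) + 1, hj⟩ : Fin (n + 1)) = j.succ := by
      ext; simp
    refine ⟨hj, ?_⟩
    rw [he, insertZero_apply_self, insertZero_apply_succAbove]
    exact Fin.succ_pos _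
  · simp only [hp, false_or]
    constructor
    · rintro ⟨h, h'⟩
      obtain ⟨h1, he⟩ := hnext h hp
      rw [he, insertZero_apply_succAbove, insertZero_apply_succAbove, Fin.succ_lt_succ_iff] at h'
      exact ⟨h1, h'⟩
    · rintro ⟨h, h'⟩
      have hlt : (p.succAbove j : ℕ) + 1 < n + 1 := by
        have : (p.succAbove j : ℕ) ≤ j + 1 := by
          rw [Fin.succAbove]; split_ifs <;> simp
        omega
      obtain ⟨h1, he⟩ := hnext hlt hp
      refine ⟨hlt, ?_⟩
      rw [he, insertZero_apply_succAbove, insertZero_apply_succAbove, Fin.succ_lt_succ_iff]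
      exact h'

theorem isRecord_insertZero_self (p : Fin (n + 1)) (σ : Perm (Fin n)) :
    IsRecord (insertZero p σ) p ↔ p = 0 := by
  constructor
  · intro h
    by_contra hp
    have := h 0 (Fin.pos_iff_ne_zero.2 hp)
    simp at this
  · rintro rfl j hj
    simp at hj

theorem isRecord_insertZero_succAbove (p : Fin (n + 1)) (σ : Perm (Fin n)) (j : Fin n) :
    IsRecord (insertZero p σ) (p.succAbove j) ↔ IsRecord σ j := by
  rw [IsRecord, Fin.forall_iff_succAbove p]
  simp [IsRecord]

/-- Number of records that are not descents. -/
def recordNondes (σ : Perm (Fin n)) : ℕ :=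
  (Finset.univ.filter fun i => IsRecord σ i ∧ ¬ IsDescent σ i).card

theorem des_insertZero (p : Fin (n + 1)) (σ : Perm (Fin n)) : des (insertZero p σ) =
    (Finset.univ.filter fun j : Fin n => p = j.succ ∨ IsDescent σ j).card := by
  rw [des, card_filter_succAbove _ p, if_neg (isDescent_insertZero_self p σ), zero_add]
  simp only [isDescent_insertZero_succAbove]

theorem des2_insertZero (p : Fin (n + 1)) (σ : Perm (Fin n)) : des2 (insertZero p σ) =
    (Finset.univ.filter fun j : Fin n => (p = j.succ ∨ IsDescent σ j) ∧ IsRecord σ j).card := by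
  have h : ∀ j, IsDescent2 (insertZero p σ) j ↔
      IsDescent (insertZero p σ) j ∧ IsRecord (insertZero p σ) j := fun _ => Iff.rfl
  rw [des2, card_filter_succAbove _ p, if_neg fun h => isDescent_insertZero_self p σ h.1, zero_add]
  simp only [h, isDescent_insertZero_succAbove, isRecord_insertZero_succAbove]

theorem recordNondes_insertZero (p : Fin (n + 1)) (σ : Perm (Fin n)) :
    recordNondes (insertZero p σ) = (if p = 0 then 1 else 0) +
    (Finset.univ.filter fun j : Fin n =>
      IsRecord σ j ∧ ¬ (p = j.succ ∨ IsDescent σ j)).card := by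
  rw [recordNondes, card_filter_succAbove _ p]
  simp only [isDescent_insertZero_self, isRecord_insertZero_self, isDescent_insertZero_succAbove,
    isRecord_insertZero_succAbove, not_false_eq_true, and_true]

theorem des2_eq (σ : Perm (Fin n)) :
    des2 σ = (Finset.univ.filter fun j => IsDescent σ j ∧ IsRecord σ j).card := rfl

/-- Old records survive the insertion. In front, `0` is a new record that is not a descent. Right
after `q` it makes `q` a descent: nothing changes if `q` was one already, and the descent is of type
2 exactly when `q` is a record. -/
theorem sum_des_succ (n : ℕ) (f : ℕ × ℕ × ℕ → ℕ) :
    ∑ σ : Perm (Fin (n + 1)), f (des σ, des2 σ, recordNondes σ) =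
      ∑ σ : Perm (Fin n), insertionStep n f (des σ, des2 σ, recordNondes σ) := by
  rw [← (Equiv.ofBijective _ insertZero_bijective).sum_comp, Fintype.sum_prod_type_right]
  refine Finset.sum_congr rfl fun σ _ => ?_
  rw [insertionStep_eq_sum (IsDescent σ) (fun q => IsRecord σ q ∧ ¬ IsDescent σ q)
    (fun q h h' => h'.2 h) f _ rfl rfl, Fin.sum_univ_succ]
  simp only [Equiv.ofBijective_apply, des_insertZero, des2_insertZero, recordNondes_insertZero,
    Fin.succ_ne_zero, (Fin.succ_ne_zero _).symm, if_true, if_false, false_or, zero_add,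
    Fin.succ_inj]
  congr 1
  · rw [add_comm 1]; rfl
  refine Finset.sum_congr rfl fun q _ => ?_
  by_cases hD : IsDescent σ q
  · rw [if_pos hD]
    have : ∀ j, (q = j ∨ IsDescent σ j) ↔ IsDescent σ j := fun j =>
      ⟨by rintro (rfl | h); exacts [hD, h], .inr⟩
    simp only [this]; rfl
  rw [if_neg hD]
  have h1 : (Finset.univ.filter fun j => q = j ∨ IsDescent σ j).card = des σ + 1 := by
    simp only [eq_comm (a := q)]; exact card_filter_eq_or hD
  by_cases hR : IsRecord σ q
  · rw [if_pos ⟨hR, hD⟩, h1]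
    have h2 : (Finset.univ.filter fun j => (q = j ∨ IsDescent σ j) ∧ IsRecord σ j).card =
        des2 σ + 1 := by
      rw [des2_eq, ← card_filter_eq_or (q := q) fun h => hD h.1]
      congr 1
      ext j
      simp only [Finset.mem_filter, Finset.mem_univ, true_and]
      constructor
      · rintro ⟨rfl | h, h'⟩; exacts [.inl rfl, .inr ⟨h, h'⟩]
      · rintro (rfl | h); exacts [⟨.inl rfl, hR⟩, ⟨.inr h.1, h.2⟩]
    have h3 : (Finset.univ.filter fun j => IsRecord σ j ∧ ¬ (q = j ∨ IsDescent σ j)).card =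
        recordNondes σ - 1 := by
      rw [recordNondes, ← card_filter_ne_and (q := q) ⟨hR, hD⟩]
      congr 1
      ext j
      simp only [Finset.mem_filter, Finset.mem_univ, true_and, not_or, ne_eq, eq_comm (a := j)]
      tauto
    rw [h2, h3]
  · rw [if_neg fun h => hR h.1, h1]
    have h2 : ∀ j, ((q = j ∨ IsDescent σ j) ∧ IsRecord σ j) ↔ (IsDescent σ j ∧ IsRecord σ j) := by
      intro j
      constructor
      · rintro ⟨rfl | h, h'⟩; exacts [absurd h' hR, ⟨h, h'⟩]
      · rintro ⟨h, h'⟩; exact ⟨.inr h, h'⟩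
    have h3 : ∀ j, (IsRecord σ j ∧ ¬ (q = j ∨ IsDescent σ j)) ↔
        (IsRecord σ j ∧ ¬ IsDescent σ j) := by
      intro j
      constructor
      · rintro ⟨h, h'⟩; exact ⟨h, fun hd => h' (.inr hd)⟩
      · rintro ⟨h, h'⟩
        refine ⟨h, ?_⟩
        rintro (rfl | hd); exacts [hR h, h' hd]
    simp only [h2, h3]; rfl

/-! ### Inserting a least element into a cycle: excedances and cycles. -/

/-- The permutation `decomposeFin.symm (p, e)` is `e`, shifted by one, with `0` inserted just before
`p` in its cycle, or as a fixed point if `p = 0`. -/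
theorem sameCycle_decomposeFin_symm_succ (p : Fin (n + 1)) (e : Perm (Fin n)) (a b : Fin n) :
    (decomposeFin.symm (p, e)).SameCycle a.succ b.succ ↔ e.SameCycle a b := by
  set τ := decomposeFin.symm (p, e) with hτ
  have hsucc : ∀ x : Fin n, (e x).succ ≠ p → τ x.succ = (e x).succ := fun x hx => by
    rw [hτ, decomposeFin_symm_apply_succ, swap_apply_of_ne_of_ne (Fin.succ_ne_zero _) hx]
  have hsucc' : ∀ x : Fin n, (e x).succ = p → τ x.succ = 0 := fun x hx => by
    rw [hτ, decomposeFin_symm_apply_succ, hx, swap_apply_right]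
  have hzero : τ 0 = p := decomposeFin_symm_apply_zero p e
  constructor
  · intro h
    obtain ⟨m, hm⟩ := h.exists_nat_pow_eq
    -- The second clause carries the induction through `0`, from which the path continues to `p`.
    have key : ∀ m : ℕ, (∀ b : Fin n, (τ ^ m) a.succ = b.succ → e.SameCycle a b) ∧
        ((τ ^ m) a.succ = 0 → ∀ b : Fin n, p = b.succ → e.SameCycle a b) := by
      intro m
      induction m with
      | zero =>
        refine ⟨fun b hb => ?_, fun h0 => absurd h0 (Fin.succ_ne_zero _)⟩
        rw [Fin.succ_injective _ (show a.succ = b.succ from hb)]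
      | succ m ih =>
        rw [pow_succ', Perm.mul_apply]
        rcases Fin.eq_zero_or_eq_succ ((τ ^ m) a.succ) with h0 | ⟨c, hc⟩
        · rw [h0, hzero]
          exact ⟨ih.2 h0, fun hp b hb => absurd (hb.symm.trans hp) (Fin.succ_ne_zero _)⟩
        · have hac := sameCycle_apply_right.2 (ih.1 c hc)
          rw [hc]
          by_cases hec : (e c).succ = p
          · rw [hsucc' c hec]
            refine ⟨fun b hb => absurd hb.symm (Fin.succ_ne_zero _), fun _ b hb => ?_⟩
            rwa [← Fin.succ_injective _ (hec.trans hb)]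
          · rw [hsucc c hec]
            refine ⟨fun b hb => ?_, fun h0 => absurd h0 (Fin.succ_ne_zero _)⟩
            rwa [← Fin.succ_injective _ hb]
    exact (key m).1 b hm
  · intro h
    obtain ⟨m, rfl⟩ := h.exists_nat_pow_eq
    induction m with
    | zero => exact SameCycle.refl _ _
    | succ m ih =>
      refine (ih ⟨m, by simp⟩).trans ?_
      rw [pow_succ', Perm.mul_apply]
      by_cases hec : (e ((e ^ m) a)).succ = p
      · refine ⟨2, ?_⟩
        rw [show (2 : ℤ) = ((2 : ℕ) : ℤ) from rfl, zpow_natCast, pow_two, Perm.mul_apply,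
          hsucc' _ hec, hzero, hec]
      · exact ⟨1, by rw [zpow_one, hsucc _ hec]⟩

theorem isCycleMax_decomposeFin_symm_succ (p : Fin (n + 1)) (e : Perm (Fin n)) (j : Fin n) :
    IsCycleMax j.succ (decomposeFin.symm (p, e)) ↔ IsCycleMax j e := by
  simp [IsCycleMax, Fin.forall_fin_succ, sameCycle_decomposeFin_symm_succ]

theorem decomposeFin_symm_apply_succ_of_succ (e : Perm (Fin n)) (i j : Fin n) :
    decomposeFin.symm ((e i).succ, e) j.succ = if j = i then 0 else (e j).succ := by
  rw [decomposeFin_symm_apply_succ]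
  split_ifs with h
  · rw [h, swap_apply_right]
  · rw [swap_apply_of_ne_of_ne (Fin.succ_ne_zero _)]
    exact fun h' => h (e.injective (Fin.succ_injective _ h'))

theorem card_filter_succ (P : Fin (n + 1) → Prop) [DecidablePred P] :
    (Finset.univ.filter P).card =
      (if P 0 then 1 else 0) + (Finset.univ.filter fun j : Fin n => P j.succ).card := by
  rw [Finset.card_filter, Fin.sum_univ_succ, Finset.card_filter]

theorem exc_eq (σ : Perm (Fin n)) : exc σ = (Finset.univ.filter fun i => i < σ i).card := rfl

theorem exc_decomposeFin_symm_zero (e : Perm (Fin n)) : exc (decomposeFin.symm (0, e)) = exc e := by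
  rw [exc_eq, card_filter_succ, exc_eq]
  simp

theorem fix_decomposeFin_symm_zero (e : Perm (Fin n)) :
    fix (decomposeFin.symm (0, e)) = fix e + 1 := by
  rw [fix, card_filter_succ, add_comm]
  simp [fix]

theorem pcyc_decomposeFin_symm_zero (e : Perm (Fin n)) :
    pcyc (decomposeFin.symm (0, e)) = pcyc e := by
  rw [pcyc_eq_card_ne, card_filter_succ, pcyc_eq_card_ne]
  simp [isCycleMax_decomposeFin_symm_succ]

/-- The new element `0` becomes an excedance, while the shifted `i`, now sent to `0`, is not one. -/
theorem exc_decomposeFin_symm_succ (e : Perm (Fin n)) (i : Fin n) :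
    exc (decomposeFin.symm ((e i).succ, e)) = if i < e i then exc e else exc e + 1 := by
  rw [exc_eq, card_filter_succ, exc_eq]
  simp only [decomposeFin_symm_apply_succ_of_succ, decomposeFin_symm_apply_zero,
    Fin.succ_pos, if_true]
  have h : ∀ j, (j.succ < if j = i then 0 else (e j).succ) ↔ j ≠ i ∧ j < e j := by
    intro j
    split_ifs with h <;> simp [h]
  simp only [h]
  split_ifs with hi
  · rw [card_filter_ne_and (P := fun j => j < e j) hi]
    have : 0 < (Finset.univ.filter fun j => j < e j).card :=
      Finset.card_pos.2 ⟨i, by simpa using hi⟩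
    omega
  · rw [add_comm]
    congr 2
    ext j
    simp only [Finset.mem_filter, Finset.mem_univ, true_and, and_iff_right_iff_imp]
    rintro hj rfl; exact hi hj

theorem fix_decomposeFin_symm_succ (e : Perm (Fin n)) (i : Fin n) :
    fix (decomposeFin.symm ((e i).succ, e)) = if e i = i then fix e - 1 else fix e := by
  rw [fix, card_filter_succ]
  simp only [decomposeFin_symm_apply_succ_of_succ, decomposeFin_symm_apply_zero,
    Fin.succ_ne_zero, if_false, zero_add]
  have h : ∀ j, ((if j = i then 0 else (e j).succ) = j.succ) ↔ j ≠ i ∧ e j = j := by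
    intro j
    split_ifs with h <;> simp [h, (Fin.succ_ne_zero _).symm]
  simp only [h]
  split_ifs with hi
  · rw [card_filter_ne_and (P := fun j => e j = j) hi, fix]
  · rw [fix]
    congr 1
    ext j
    simp only [Finset.mem_filter, Finset.mem_univ, true_and, and_iff_right_iff_imp]
    rintro hj rfl; exact hi hj

theorem pcyc_decomposeFin_symm_succ (e : Perm (Fin n)) (i : Fin n) :
    pcyc (decomposeFin.symm ((e i).succ, e)) = if e i = i then pcyc e + 1 else pcyc e := by
  have hzero : ¬ IsCycleMax 0 (decomposeFin.symm ((e i).succ, e)) := fun h =>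
    (Fin.succ_pos (e i)).not_ge (h _ ⟨1, by rw [zpow_one, decomposeFin_symm_apply_zero]⟩)
  rw [pcyc_eq_card_ne, card_filter_succ, if_neg fun h => hzero h.2, zero_add, pcyc_eq_card_ne]
  simp only [decomposeFin_symm_apply_succ_of_succ, isCycleMax_decomposeFin_symm_succ]
  have h : ∀ j, ((if j = i then 0 else (e j).succ) ≠ j.succ) ↔ j = i ∨ e j ≠ j := by
    intro j
    split_ifs with h <;> simp [h, (Fin.succ_ne_zero _).symm]
  simp only [h]
  split_ifs with hi
  · rw [← card_filter_eq_or (q := i) fun h => h.1 hi]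
    congr 1
    ext j
    simp only [Finset.mem_filter, Finset.mem_univ, true_and]
    constructor
    · rintro ⟨h1 | h1, h2⟩; exacts [.inl h1, .inr ⟨h1, h2⟩]
    · rintro (rfl | h)
      · exact ⟨.inl rfl, fun x hx => (hx.eq_of_left hi).ge⟩
      · exact ⟨.inr h.1, h.2⟩
  · congr 1
    ext j
    simp only [Finset.mem_filter, Finset.mem_univ, true_and, and_congr_left_iff, or_iff_right_iff_imp]
    rintro - rfl; exact hi

/-- Besides the new fixed point, `0` may be inserted between `i` and `e i`. An excedance `i` changes
nothing, a fixed point becomes a nontrivial cycle with one excedance, and an antiexcedance only adds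
an excedance. -/
theorem sum_exc_succ (n : ℕ) (f : ℕ × ℕ × ℕ → ℕ) :
    ∑ σ : Perm (Fin (n + 1)), f (exc σ, pcyc σ, fix σ) =
      ∑ σ : Perm (Fin n), insertionStep n f (exc σ, pcyc σ, fix σ) := by
  rw [← decomposeFin.symm.sum_comp, Fintype.sum_prod_type_right]
  refine Finset.sum_congr rfl fun e _ => ?_
  rw [insertionStep_eq_sum (fun i => i < e i) (fun i => e i = i)
    (fun q h h' => h.ne h'.symm) f _ rfl rfl, Fin.sum_univ_succ]
  -- Reindexing by `e` names the insertion by the preimage `i` of the point before which `0` is put.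
  rw [exc_decomposeFin_symm_zero, pcyc_decomposeFin_symm_zero, fix_decomposeFin_symm_zero,
    ← Equiv.sum_comp e]
  congr 1
  refine Finset.sum_congr rfl fun i _ => ?_
  rw [exc_decomposeFin_symm_succ, pcyc_decomposeFin_symm_succ, fix_decomposeFin_symm_succ]
  by_cases h1 : i < e i
  · simp [h1, h1.ne']
  · by_cases h2 : e i = i <;> simp [h1, h2]

theorem equidistributed_exc_pcyc_des_des2 (n : ℕ) :
    Equidistributed n (fun σ => (exc σ, pcyc σ)) (fun σ => (des σ, des2 σ)) := by
  intro p
  -- The test function is the indicator of `p` in the first two coordinates, which forgets the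
  -- auxiliary third statistic.
  have := sum_eq_sum_of_insertionStep (fun _ σ => (exc σ, pcyc σ, fix σ))
    (fun _ σ => (des σ, des2 σ, recordNondes σ)) rfl sum_exc_succ sum_des_succ n
    fun x => if (x.1, x.2.1) = p then 1 else 0
  simpa only [← Finset.card_filter] using this

end PermStat

theorem corollary1p4 (n : ℕ) :
    PermStat.Equidistributed n
      (fun σ => (PermStat.exc σ, PermStat.pcyc σ)) (fun σ => (PermStat.exc σ, PermStat.ear σ)) ∧
    PermStat.Equidistributed n
      (fun σ => (PermStat.exc σ, PermStat.ear σ)) (fun σ => (PermStat.des σ, PermStat.des2 σ)) ∧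
    PermStat.Equidistributed n
      (fun σ => (PermStat.des σ, PermStat.des2 σ)) (fun σ => (PermStat.exc σ, PermStat.pex σ)) ∧
    PermStat.Equidistributed n
      (fun σ => (PermStat.des2 σ, PermStat.des σ)) (fun σ => (PermStat.pex σ, PermStat.exc σ)) := by
  have hear := PermStat.equidistributed_exc_pcyc_exc_ear n
  have hdes := PermStat.equidistributed_exc_pcyc_des_des2 n
  have hpex := PermStat.equidistributed_exc_pcyc_exc_pex n
  refine ⟨hear, hear.symm.trans hdes, hdes.symm.trans hpex, fun p => ?_⟩
  have := (hdes.symm.trans hpex) (p.2, p.1)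
  simpa only [Prod.ext_iff, and_comm] using this
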